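/- Let $W,Z$ be real-valued continuous random variables and let $X,Y$ be random variables, each discrete or continuous, such that $(W,Z,X,Y)$ has a joint density $f(w,z,x,y)$ with respect to the product of Lebesgue measure in $w$ and $z$ and $\sigma$-finite reference measures for $X$ and $Y$ (counting measure or Lebesgue measure, say). Write $f(w\mid z,x)$, $f(z\mid w,x)$, $f(w\mid x)$, $f(z\mid x)$ and $\mathrm{pr}(y\mid z,x)$ for the conditional densities (or mass functions) obtained from it, and $F(w\mid x)$, $F(z\mid x)$ for the conditional laws of $W$ and $Z$ given $X=x$. For $x$ with $0<f(x)<\infty$ let $K_x:L^2\{F(w\mid x)\}\to L^2\{F(z\mid x)\}$ be the conditional expectation operator $$K_xh=E\{h(W)\mid z,x\}=\int_{-\infty}^{+\infty}h(w)f(w\mid z,x)\,dw .$$ A singular value decomposition of $K_x$ is a sequence $(\lambda_{x,n},\varphi_{x,n},\psi_{x,n})_{n\ge1}$ with $\lambda_{x,n}>0$, $(\varphi_{x,n})_n$ orthonormal in $L^2\{F(w\mid x)\}$, $(\psi_{x,n})_n$ orthonormal in $L^2\{F(z\mid x)\}$, and $K_xh=\sum_n\lambda_{x,n}\langle\varphi_{x,n},h\rangle\psi_{x,n}$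 for all $h$. Consider the following conditions. (iii) For every $g$ with $\int g(z)^2f(z\mid x)\,dz<\infty$: $E\{g(Z)\mid w,x\}=\int g(z)f(z\mid w,x)\,dz=0$ for $F(w\mid x)$-almost every $w$ if and only if $g(z)=0$ for $F(z\mid x)$-almost every $z$. (v) $\int\!\!\int f(w\mid z,x)f(z\mid w,x)\,dw\,dz<\infty$. (vi) $\int \mathrm{pr}(y\mid z,x)^2f(z\mid x)\,dz<\infty$. (vii) $\sum_{n}\lambda_{x,n}^{-2}\,|\langle \mathrm{pr}(y\mid\cdot,x),\psi_{x,n}\rangle|^2<\infty$, with the inner product of $L^2\{F(z\mid x)\}$. Then, for every $x$ with $0<f(x)<\infty$ at which (iii) and (v) hold, $K_x$ has a singular value decomposition. Moreover there is a function $h(w,x,y)$ such that for every $x$ with $0<f(x)<\infty$ and every $y$ at which (iii), (v), (vi), and (vii) for some singular value decomposition of $K_x$, hold, the function $h(\cdot,x,y)$ is measurable, belongs to $L^2\{F(w\mid x)\}$, and solves the Fredholm integral equation $$\mathrm{pr}(y\mid z,x)=\int_{-\infty}^{+\infty}h(w,x,y)f(w\mid z,x)\,dw\qquad\text{for }F(z\mid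 x)\text{-almost every }z,$$ the integral converging absolutely. In particular, if the conditions hold for all such $(x,y)$, then $h$ solves the equation for all of them. -/

import Mathlib

open MeasureTheory
open scoped ENNReal

noncomputable section

/-- The joint probability density `f(w, z, x, y)` of `(W, Z, X, Y)`, where `W` and `Z` are real
random variables with reference measure `dw`, `dz` (Lebesgue), and `X`, `Y` have densities with
respect to `ρ`, `ν` (counting measure for a discrete variable, Lebesgue measure for a
continuous one). -/
structure JointDensity {𝒳 𝒴 : Type*} [MeasurableSpace 𝒳] [MeasurableSpace 𝒴]
    (ρ : Measure 𝒳) (ν : Measure 𝒴) where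
  /-- the density `f(w, z, x, y)` -/
  toFun : ℝ → ℝ → 𝒳 → 𝒴 → ℝ≥0∞
  measurable_toFun :
    Measurable fun t : ℝ × ℝ × 𝒳 × 𝒴 => toFun t.1 t.2.1 t.2.2.1 t.2.2.2
  lintegral_eq_one : ∫⁻ w, ∫⁻ z, ∫⁻ x, ∫⁻ y, toFun w z x y ∂ν ∂ρ = 1

/-- A singular value decomposition `(λ_n, φ_n, ψ_n)` of a bounded operator `K` between real Hilbert
spaces: `λ_n > 0`, `(φ_n)` and `(ψ_n)` are orthonormal, and `K h = ∑ λ_n ⟨φ_n, h⟩ ψ_n` for all `h`.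
(Hence `K φ_n = λ_n ψ_n`, `K* ψ_n = λ_n φ_n`, and `(λ_n)` exhausts the nonzero singular values with
multiplicity. No ordering of the `λ_n` is required.) -/
structure SingularSystem {H E : Type*} [NormedAddCommGroup H] [InnerProductSpace ℝ H]
    [NormedAddCommGroup E] [InnerProductSpace ℝ E] (K : H →L[ℝ] E) where
  /-- the singular values `λ_n` -/
  value : ℕ → ℝ
  /-- the right singular vectors `φ_n` -/
  right : ℕ → H
  /-- the left singular vectors `ψ_n` -/
  left : ℕ → E
  value_pos : ∀ n, 0 < value n
  orthonormal_right : Orthonormal ℝ right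
  orthonormal_left : Orthonormal ℝ left
  hasSum_apply : ∀ h : H, HasSum (fun n => (value n * inner ℝ (right n) h) • left n) (K h)

namespace JointDensity

variable {𝒳 𝒴 : Type*} [MeasurableSpace 𝒳] [MeasurableSpace 𝒴]
  {ρ : Measure 𝒳} {ν : Measure 𝒴} (f : JointDensity ρ ν)

/-- The marginal density `f(w, z, x)`. -/
def fWZX (w z : ℝ) (x : 𝒳) : ℝ≥0∞ := ∫⁻ y, f.toFun w z x y ∂ν

/-- The marginal density `f(z, x, y)`. -/
def fZXY (z : ℝ) (x : 𝒳) (y : 𝒴) : ℝ≥0∞ := ∫⁻ w, f.toFun w z x y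

/-- The marginal density `f(w, x)`. -/
def fWX (w : ℝ) (x : 𝒳) : ℝ≥0∞ := ∫⁻ z, f.fWZX w z x

/-- The marginal density `f(z, x)`. -/
def fZX (z : ℝ) (x : 𝒳) : ℝ≥0∞ := ∫⁻ w, f.fWZX w z x

/-- The marginal density `f(x)`. -/
def fX (x : 𝒳) : ℝ≥0∞ := ∫⁻ z, f.fZX z x

/-- The conditional density `f(w | z, x)`. -/
def wGivenZX (w z : ℝ) (x : 𝒳) : ℝ≥0∞ := f.fWZX w z x / f.fZX z x

/-- The conditional density `f(z | w, x)`. -/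
def zGivenWX (z w : ℝ) (x : 𝒳) : ℝ≥0∞ := f.fWZX w z x / f.fWX w x

/-- The conditional density `f(w | x)`. -/
def wGivenX (w : ℝ) (x : 𝒳) : ℝ≥0∞ := f.fWX w x / f.fX x

/-- The conditional density `f(z | x)`. -/
def zGivenX (z : ℝ) (x : 𝒳) : ℝ≥0∞ := f.fZX z x / f.fX x

/-- The conditional density (or probability mass function) `pr(y | z, x)`. -/
def prY (y : 𝒴) (z : ℝ) (x : 𝒳) : ℝ≥0∞ := f.fZXY z x y / f.fZX z x

/-- The conditional law `F(w | x)` of `W` given `X = x`. -/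
def lawW (x : 𝒳) : Measure ℝ := volume.withDensity fun w => f.wGivenX w x

/-- The conditional law `F(z | x)` of `Z` given `X = x`. -/
def lawZ (x : 𝒳) : Measure ℝ := volume.withDensity fun z => f.zGivenX z x

/-- The function `z ↦ E{h(W) | Z = z, X = x} = ∫ h(w) f(w | z, x) dw`. -/
def condExpW (x : 𝒳) (h : ℝ → ℝ) (z : ℝ) : ℝ := ∫ w, h w * (f.wGivenZX w z x).toReal

/-- The function `w ↦ E{g(Z) | W = w, X = x} = ∫ g(z) f(z | w, x) dz`. -/
def condExpZ (x : 𝒳) (g : ℝ → ℝ) (w : ℝ) : ℝ := ∫ z, g z * (f.zGivenWX z w x).toReal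

/-! ### The conditional expectation operator is well defined -/

section Aux

theorem lintegral_enorm_sq_eq {μ : Measure ℝ} (h : ℝ → ℝ) :
    ∫⁻ t, ‖h t‖ₑ ^ 2 ∂μ = eLpNorm h 2 μ ^ 2 := by
  have := eLpNorm_nnreal_pow_eq_lintegral (f := h) (μ := μ) (p := 2) (by norm_num)
  simpa using this.symm

theorem enorm_mul_toReal_le (x : 𝒳) (h : ℝ → ℝ) (w z : ℝ) :
    ‖h w * (f.wGivenZX w z x).toReal‖ₑ ≤ ‖h w‖ₑ * f.wGivenZX w z x := by
  rw [enorm_mul]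
  gcongr
  rw [Real.enorm_eq_ofReal ENNReal.toReal_nonneg]
  exact ENNReal.ofReal_toReal_le

variable [SFinite ν]

theorem measurable_fWZX (x : 𝒳) : Measurable fun t : ℝ × ℝ => f.fWZX t.1 t.2 x := by
  have h : Measurable fun t : (ℝ × ℝ) × 𝒴 => f.toFun t.1.1 t.1.2 x t.2 :=
    f.measurable_toFun.comp (g := fun t : ℝ × ℝ × 𝒳 × 𝒴 => f.toFun t.1 t.2.1 t.2.2.1 t.2.2.2)
      (f := fun t : (ℝ × ℝ) × 𝒴 => (t.1.1, t.1.2, x, t.2)) (by fun_prop)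
  exact h.lintegral_prod_right'

theorem measurable_fWX (x : 𝒳) : Measurable fun w => f.fWX w x :=
  (f.measurable_fWZX x).lintegral_prod_right'

theorem measurable_fZX (x : 𝒳) : Measurable fun z => f.fZX z x :=
  (f.measurable_fWZX x).lintegral_prod_left'

theorem measurable_wGivenZX (x : 𝒳) : Measurable fun t : ℝ × ℝ => f.wGivenZX t.1 t.2 x :=
  (f.measurable_fWZX x).div ((f.measurable_fZX x).comp measurable_snd)

theorem measurable_wGivenZX_left (x : 𝒳) (z : ℝ) : Measurable fun w => f.wGivenZX w z x :=
  (f.measurable_wGivenZX x).comp (by fun_prop : Measurable fun w : ℝ => (w, z))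

theorem lintegral_wGivenZX_le (x : 𝒳) (z : ℝ) : ∫⁻ w, f.wGivenZX w z x ≤ 1 := by
  have hm : Measurable fun w => f.fWZX w z x :=
    (f.measurable_fWZX x).comp (by fun_prop : Measurable fun w : ℝ => (w, z))
  simp only [wGivenZX, div_eq_mul_inv]
  rw [lintegral_mul_const _ hm]
  exact ENNReal.div_self_le_one

theorem lintegral_lintegral_le (x : 𝒳) {φ : ℝ → ℝ≥0∞} (hφ : Measurable φ) :
    ∫⁻ z, ∫⁻ w, φ w * f.wGivenZX w z x ∂volume ∂(f.lawZ x) ≤ ∫⁻ w, φ w ∂(f.lawW x) := by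
  have hz : Measurable fun z => f.zGivenX z x := (f.measurable_fZX x).div_const _
  have hw : Measurable fun w => f.wGivenX w x := (f.measurable_fWX x).div_const _
  have hinner : Measurable fun z => ∫⁻ w, φ w * f.wGivenZX w z x :=
    Measurable.lintegral_prod_left' (f := fun t : ℝ × ℝ => φ t.1 * f.wGivenZX t.1 t.2 x)
      ((hφ.comp measurable_fst).mul (f.measurable_wGivenZX x))
  have hF : Measurable fun t : ℝ × ℝ => φ t.1 * (f.fWZX t.1 t.2 x / f.fX x) :=
    (hφ.comp measurable_fst).mul ((f.measurable_fWZX x).div_const _)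
  rw [lawZ, lawW, lintegral_withDensity_eq_lintegral_mul _ hz hinner,
    lintegral_withDensity_eq_lintegral_mul _ hw hφ]
  calc ∫⁻ z, ((fun z => f.zGivenX z x) * fun z => ∫⁻ w, φ w * f.wGivenZX w z x) z
      ≤ ∫⁻ z, ∫⁻ w, φ w * (f.fWZX w z x / f.fX x) := by
        refine lintegral_mono fun z => ?_
        have hm : Measurable fun w => φ w * f.wGivenZX w z x :=
          hφ.mul (f.measurable_wGivenZX_left x z)
        simp only [Pi.mul_apply]
        rw [← lintegral_const_mul _ hm]
        refine lintegral_mono fun w => ?_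
        have h1 : f.fWZX w z x / f.fZX z x * f.fZX z x ≤ f.fWZX w z x :=
          ENNReal.mul_le_of_le_div le_rfl
        calc f.zGivenX z x * (φ w * f.wGivenZX w z x)
            = φ w * ((f.fWZX w z x / f.fZX z x * f.fZX z x) / f.fX x) := by
              simp only [zGivenX, wGivenZX, div_eq_mul_inv]; ring
          _ ≤ φ w * (f.fWZX w z x / f.fX x) := by gcongr
    _ = ∫⁻ w, ∫⁻ z, φ w * (f.fWZX w z x / f.fX x) :=
        (lintegral_lintegral_swap (f := fun w z => φ w * (f.fWZX w z x / f.fX x))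
          hF.aemeasurable).symm
    _ ≤ ∫⁻ w, ((fun w => f.wGivenX w x) * φ) w := by
        refine lintegral_mono fun w => le_of_eq ?_
        have hm : Measurable fun z => f.fWZX w z x :=
          (f.measurable_fWZX x).comp (by fun_prop : Measurable fun z : ℝ => (w, z))
        simp only [Pi.mul_apply, div_eq_mul_inv, wGivenX]
        rw [lintegral_const_mul _ (hm.mul_const _), lintegral_mul_const _ hm, mul_comm]
        rfl

theorem sq_lintegral_le (x : 𝒳) {h : ℝ → ℝ} (hh : Measurable h) (z : ℝ) :
    (∫⁻ w, ‖h w‖ₑ * f.wGivenZX w z x) ^ 2 ≤ ∫⁻ w, ‖h w‖ₑ ^ 2 * f.wGivenZX w z x := by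
  have hd := f.measurable_wGivenZX_left x z
  set κ : Measure ℝ := volume.withDensity fun w => f.wGivenZX w z x with hκ
  have hκ1 : κ Set.univ ≤ 1 := by
    rw [hκ, withDensity_apply _ MeasurableSet.univ, Measure.restrict_univ]
    exact f.lintegral_wGivenZX_le x z
  have e1 : ∫⁻ w, ‖h w‖ₑ * f.wGivenZX w z x = ∫⁻ w, ‖h w‖ₑ ∂κ := by
    rw [hκ, lintegral_withDensity_eq_lintegral_mul _ hd hh.enorm]
    exact lintegral_congr fun w => mul_comm _ _
  have e2 : ∫⁻ w, ‖h w‖ₑ ^ 2 * f.wGivenZX w z x = ∫⁻ w, ‖h w‖ₑ ^ 2 ∂κ := by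
    rw [hκ, lintegral_withDensity_eq_lintegral_mul _ hd (hh.enorm.pow_const 2)]
    exact lintegral_congr fun w => mul_comm _ _
  have hle : eLpNorm h 1 κ ≤ eLpNorm h 2 κ := by
    refine (eLpNorm_le_eLpNorm_mul_rpow_measure_univ (by norm_num : (1 : ℝ≥0∞) ≤ 2)
      hh.aestronglyMeasurable).trans ?_
    refine mul_le_of_le_one_right' (ENNReal.rpow_le_one hκ1 (by norm_num))
  have h2 : eLpNorm h 2 κ ^ 2 = ∫⁻ w, ‖h w‖ₑ ^ 2 ∂κ := by
    have := eLpNorm_nnreal_pow_eq_lintegral (f := h) (μ := κ) (p := 2) (by norm_num)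
    simpa using this
  rw [e1, e2, ← h2, ← eLpNorm_one_eq_lintegral_enorm]
  gcongr

theorem lintegral_enorm_condExpW_sq_le (x : 𝒳) {h : ℝ → ℝ} (hh : Measurable h) :
    ∫⁻ z, ‖f.condExpW x h z‖ₑ ^ 2 ∂(f.lawZ x) ≤ ∫⁻ w, ‖h w‖ₑ ^ 2 ∂(f.lawW x) := by
  refine le_trans (lintegral_mono fun z => ?_)
    (f.lintegral_lintegral_le x (hh.enorm.pow_const 2))
  refine le_trans ?_ (f.sq_lintegral_le x hh z)
  gcongr
  exact (enorm_integral_le_lintegral_enorm _).trans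
    (lintegral_mono fun w => f.enorm_mul_toReal_le x h w z)

theorem measurable_condExpW (x : 𝒳) {h : ℝ → ℝ} (hh : Measurable h) :
    StronglyMeasurable (f.condExpW x h) := by
  have : Measurable fun t : ℝ × ℝ => h t.2 * (f.wGivenZX t.2 t.1 x).toReal :=
    (hh.comp measurable_snd).mul
      ((f.measurable_wGivenZX x).comp measurable_swap).ennreal_toReal
  exact StronglyMeasurable.integral_prod_right this.stronglyMeasurable

theorem eLpNorm_condExpW_le (x : 𝒳) {h : ℝ → ℝ} (hh : Measurable h) :
    eLpNorm (f.condExpW x h) 2 (f.lawZ x) ≤ eLpNorm h 2 (f.lawW x) := by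
  have := f.lintegral_enorm_condExpW_sq_le x hh
  rw [lintegral_enorm_sq_eq, lintegral_enorm_sq_eq] at this
  exact (ENNReal.pow_le_pow_left_iff two_ne_zero).1 this

theorem memLp_condExpW (x : 𝒳) (h : Lp ℝ 2 (f.lawW x)) :
    MemLp (f.condExpW x h) 2 (f.lawZ x) :=
  ⟨(f.measurable_condExpW x (Lp.stronglyMeasurable h).measurable).aestronglyMeasurable,
    (f.eLpNorm_condExpW_le x (Lp.stronglyMeasurable h).measurable).trans_lt (Lp.memLp h).2⟩

theorem condExpW_congr_ae (x : 𝒳) {h k : ℝ → ℝ} (hk : h =ᵐ[f.lawW x] k) :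
    f.condExpW x h =ᵐ[f.lawZ x] f.condExpW x k := by
  obtain ⟨s, hs, hsm, hs0⟩ := exists_measurable_superset_of_null (ae_iff.1 hk)
  have hφ : Measurable (s.indicator fun _ => (1 : ℝ≥0∞)) := measurable_const.indicator hsm
  have h0 := f.lintegral_lintegral_le x hφ
  rw [lintegral_indicator_const hsm, hs0, mul_zero, nonpos_iff_eq_zero,
    lintegral_eq_zero_iff] at h0
  · filter_upwards [h0] with z hz
    have hz := (lintegral_eq_zero_iff (hφ.mul (f.measurable_wGivenZX_left x z))).1 hz
    refine integral_congr_ae ?_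
    filter_upwards [hz] with w hw
    by_cases hws : w ∈ s
    · have : f.wGivenZX w z x = 0 := by simpa [hws] using hw
      simp [this]
    · have : h w = k w := by
        by_contra hne
        exact hws (hs hne)
      rw [this]
  · exact Measurable.lintegral_prod_left'
      (f := fun t : ℝ × ℝ => s.indicator (fun _ => (1 : ℝ≥0∞)) t.1 * f.wGivenZX t.1 t.2 x)
      ((hφ.comp measurable_fst).mul (f.measurable_wGivenZX x))

theorem integrable_condExpW (x : 𝒳) (h : Lp ℝ 2 (f.lawW x)) :
    ∀ᵐ z ∂(f.lawZ x), Integrable fun w => h w * (f.wGivenZX w z x).toReal := by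
  have hh := (Lp.stronglyMeasurable h).measurable
  have hfin : ∫⁻ z, ∫⁻ w, ‖h w‖ₑ ^ 2 * f.wGivenZX w z x ∂volume ∂(f.lawZ x) < ∞ := by
    refine (f.lintegral_lintegral_le x (hh.enorm.pow_const 2)).trans_lt ?_
    rw [lintegral_enorm_sq_eq]
    exact ENNReal.pow_lt_top (Lp.memLp h).2
  have hmeas : Measurable fun z => ∫⁻ w, ‖h w‖ₑ ^ 2 * f.wGivenZX w z x :=
    Measurable.lintegral_prod_left'
      (f := fun t : ℝ × ℝ => ‖h t.1‖ₑ ^ 2 * f.wGivenZX t.1 t.2 x)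
      (((hh.comp measurable_fst).enorm.pow_const 2).mul (f.measurable_wGivenZX x))
  filter_upwards [ae_lt_top hmeas hfin.ne] with z hz
  refine ⟨(hh.mul (f.measurable_wGivenZX_left x z).ennreal_toReal).aestronglyMeasurable, ?_⟩
  refine lt_of_le_of_lt (lintegral_mono fun w => f.enorm_mul_toReal_le x h w z) ?_
  have := (f.sq_lintegral_le x hh z).trans_lt hz
  exact (ENNReal.pow_lt_top_iff.1 this).resolve_right two_ne_zero

end Aux

/-- The conditional expectation operator `K_x : L²{F(w | x)} → L²{F(z | x)}`,
`K_x h = E{h(W) | z, x} = ∫ h(w) f(w | z, x) dw`. -/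
def condExpOp [SFinite ν] (x : 𝒳) : Lp ℝ 2 (f.lawW x) →L[ℝ] Lp ℝ 2 (f.lawZ x) :=
  LinearMap.mkContinuous
    { toFun := fun h => (f.memLp_condExpW x h).toLp (f.condExpW x h)
      map_add' := fun h k => by
        rw [← MemLp.toLp_add, MemLp.toLp_eq_toLp_iff]
        filter_upwards [f.condExpW_congr_ae x (Lp.coeFn_add h k), f.integrable_condExpW x h,
          f.integrable_condExpW x k] with z hz hh hk
        rw [hz]
        simp only [condExpW, Pi.add_apply, add_mul]
        exact integral_add hh hk
      map_smul' := fun c h => by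
        rw [RingHom.id_apply, ← MemLp.toLp_const_smul, MemLp.toLp_eq_toLp_iff]
        filter_upwards [f.condExpW_congr_ae x (Lp.coeFn_smul c h)] with z hz
        rw [hz]
        simp only [condExpW, Pi.smul_apply, smul_eq_mul, mul_assoc]
        exact integral_const_mul _ _ }
    1 fun h => by
      rw [one_mul, Lp.norm_def h]
      change ‖(f.memLp_condExpW x h).toLp (f.condExpW x h)‖ ≤ _
      rw [Lp.norm_toLp]
      exact ENNReal.toReal_mono (Lp.memLp h).2.ne
        (f.eLpNorm_condExpW_le x (Lp.stronglyMeasurable h).measurable)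

/-! ### The conditions and the integral equation -/

/-- Completeness at `x`: for every square-integrable `g`, `E{g(Z) | w, x} = 0` almost surely if and
only if `g(Z) = 0` almost surely. -/
def IsCompleteAt (x : 𝒳) : Prop :=
  ∀ g : ℝ → ℝ, MemLp g 2 (f.lawZ x) →
    ((∀ᵐ w ∂(f.lawW x), f.condExpZ x g w = 0) ↔ ∀ᵐ z ∂(f.lawZ x), g z = 0)

/-- `∫∫ f(w | z, x) f(z | w, x) dw dz < ∞`. -/
def HilbertSchmidtAt (x : 𝒳) : Prop :=
  ∫⁻ z, ∫⁻ w, f.wGivenZX w z x * f.zGivenWX z w x < ∞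

/-- `∫ pr(y | z, x)² f(z | x) dz < ∞`. -/
def SquareIntegrableAt (x : 𝒳) (y : 𝒴) : Prop :=
  ∫⁻ z, f.prY y z x ^ 2 * f.zGivenX z x < ∞

/-- `∑ λ_n⁻² |⟨pr(y | z, x), ψ_n⟩|² < ∞`, the inner product being that of `L²{F(z | x)}`. -/
def PicardAt [SFinite ν] (x : 𝒳) (y : 𝒴) (S : SingularSystem (f.condExpOp x)) : Prop :=
  Summable fun n =>
    (S.value n ^ 2)⁻¹ * |∫ z, (f.prY y z x).toReal * S.left n z ∂(f.lawZ x)| ^ 2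

/-- `h` is a square-integrable solution at `(x, y)` of
`pr(y | z, x) = ∫ h(w) f(w | z, x) dw`: the integral converges absolutely and the equation
holds for almost every `z` under `F(z | x)`. -/
def IsSolutionAt (x : 𝒳) (y : 𝒴) (h : ℝ → ℝ) : Prop :=
  Measurable h ∧ MemLp h 2 (f.lawW x) ∧
    ∀ᵐ z ∂(f.lawZ x),
      Integrable (fun w => h w * (f.wGivenZX w z x).toReal) ∧
        (f.prY y z x).toReal = ∫ w, h w * (f.wGivenZX w z x).toReal

end JointDensity

end

/-! Fix `x`. With respect to `F(w | x)`, the operator `K_x` has kernel `f(w | z, x) / f(w | x)`. Its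
squared norm in `L²` of the product of `F(z | x)` and `F(w | x)` is at most `∫∫ f(w | z, x) f(z | w,
x) dw dz`. When that integral is finite, `K_x` is Hilbert–Schmidt, hence compact
(`isCompactOperator_condExpOp`).

By Fubini, `K_x† g = 0` forces `E{g(Z) | w, x} = 0` almost surely, so completeness makes `K_x†`
injective (`adjoint_injective`). Then `K_x K_x†` is compact, symmetric and injective, and has an
orthonormal eigenbasis `(ψ_n)` of `L²{F(z | x)}`. That space is separable and infinite-dimensional,
so the basis is a sequence. Taking `λ_n = ‖K_x† ψ_n‖` and `φ_n = λ_n⁻¹ K_x† ψ_n` gives the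
decomposition.

For the equation, write `r = pr(y | ·, x)`, an element of `L²{F(z | x)}`. In any singular value
decomposition, injectivity of `K_x†` makes `(ψ_n)` complete. The Picard condition makes `∑ λ_n⁻¹
⟨ψ_n, r⟩ φ_n` converge, and `K_x` sends the sum to `∑ ⟨ψ_n, r⟩ ψ_n = r`
(`SingularSystem.exists_apply_eq`). -/

/-! ### Compact operators, singular values and Picard's criterion in Hilbert space. -/

section HilbertSpace

open Filter Topology ContinuousLinearMap

variable {H E : Type*} [NormedAddCommGroup H] [InnerProductSpace ℝ H]
  [NormedAddCommGroup E] [InnerProductSpace ℝ E]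

/-- A bounded operator with `∑ ‖K b_i‖² < ∞` for a Hilbert basis `b` (that is, a Hilbert–Schmidt
operator) is compact. -/
theorem isCompactOperator_of_summable_norm_sq [CompleteSpace E] {ι : Type*}
    (K : H →L[ℝ] E) (b : HilbertBasis ι ℝ H) (hK : Summable fun i => ‖K (b i)‖ ^ 2) :
    IsCompactOperator K := by
  classical
  -- Finite-rank truncations of `K` along the basis; they converge to `K` in operator norm.
  let F : Finset ι → H →L[ℝ] E := fun s => ∑ i ∈ s, (innerSL ℝ (b i)).smulRight (K (b i))
  have hF : ∀ s h, F s h = ∑ i ∈ s, inner ℝ (b i) h • K (b i) := fun s h => by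
    simp [F]
  have hlim : ∀ h, Tendsto (fun s => F s h) atTop (𝓝 (K h)) := fun h => by
    have := (b.hasSum_repr h).mapL K
    simpa only [hF, HasSum, SummationFilter.unconditional_filter, map_smul,
      HilbertBasis.repr_apply_apply] using this
  refine isCompactOperator_of_tendsto (l := atTop) (F := F) ?_ (Eventually.of_forall fun s => ?_)
  · rw [Metric.tendsto_atTop]
    intro ε hε
    obtain ⟨s, hs⟩ := summable_iff_vanishing_norm.1 hK ((ε / 2) ^ 2) (by positivity)
    refine ⟨s, fun n hn => lt_of_le_of_lt ?_ (half_lt_self hε)⟩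
    rw [dist_eq_norm, norm_sub_rev]
    refine ContinuousLinearMap.opNorm_le_bound _ (by positivity) fun h => ?_
    -- Since `F t h → K h`, it is enough to bound `F t h - F n h` for all `t ⊇ n`. Cauchy–Schwarz
    -- and Bessel give `ε / 2 * ‖h‖` from the tail bound `(ε / 2) ^ 2`.
    have hl : Tendsto (fun t => ‖F t h - F n h‖) atTop (𝓝 ‖(K - F n) h‖) :=
      ((hlim h).sub_const _).norm
    refine le_of_tendsto hl ((eventually_ge_atTop n).mono fun t ht => ?_)
    have hd : F t h - F n h = ∑ i ∈ t \ n, inner ℝ (b i) h • K (b i) := by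
      rw [hF, hF, ← Finset.sum_sdiff ht, add_sub_cancel_right]
    rw [hd]
    have h1 : ∑ i ∈ t \ n, ‖K (b i)‖ ^ 2 ≤ (ε / 2) ^ 2 := by
      have := hs (t \ n) (Finset.sdiff_disjoint.mono_right hn)
      rw [Real.norm_eq_abs] at this
      exact (le_abs_self _).trans this.le
    have h2 : ∑ i ∈ t \ n, ‖inner ℝ (b i) h‖ ^ 2 ≤ ‖h‖ ^ 2 := b.orthonormal.sum_inner_products_le h
    refine (norm_sum_le _ _).trans ?_
    simp only [norm_smul]
    refine abs_le_of_sq_le_sq' ?_ (by positivity) |>.2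
    calc (∑ i ∈ t \ n, ‖inner ℝ (b i) h‖ * ‖K (b i)‖) ^ 2
        ≤ (∑ i ∈ t \ n, ‖inner ℝ (b i) h‖ ^ 2) * ∑ i ∈ t \ n, ‖K (b i)‖ ^ 2 :=
          Finset.sum_mul_sq_le_sq_mul_sq _ _ _
      _ ≤ ‖h‖ ^ 2 * (ε / 2) ^ 2 := by gcongr
      _ = (ε / 2 * ‖h‖) ^ 2 := by ring
  · have : F s = ∑ i ∈ s, (innerSL ℝ (b i)).smulRight (K (b i)) := rfl
    rw [this]
    refine Submodule.sum_mem (compactOperator (RingHom.id ℝ) H E) (fun i _ => ?_)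
    have hinner : IsCompactOperator (innerSL ℝ (b i)) :=
      isCompactOperator_of_locallyCompactSpace_dom (innerSL ℝ (b i))
    exact hinner.clm_comp ((ContinuousLinearMap.id ℝ ℝ).smulRight (K (b i)))

/-- Distinct orthonormal vectors are `√2` apart, so the balls of radius `1 / 2` around them are
disjoint. -/
theorem Orthonormal.countable [TopologicalSpace.SeparableSpace E] {ι : Type*} {v : ι → E}
    (hv : Orthonormal ℝ v) : Countable ι := by
  refine Pairwise.countable_of_isOpen_disjoint (s := fun i => Metric.ball (v i) (1 / 2))
    (fun i j hij => ?_) (fun i => Metric.isOpen_ball)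
    fun i => ⟨v i, Metric.mem_ball_self (by norm_num)⟩
  refine Metric.ball_disjoint_ball ?_
  have h := norm_sub_sq_real (v i) (v j)
  rw [hv.2 hij, hv.1, hv.1, ← dist_eq_norm] at h
  nlinarith [dist_nonneg (x := v i) (y := v j)]

/-- A compact symmetric operator has a Hilbert basis of eigenvectors. -/
theorem exists_hilbertBasis_eigenvectors.{u} {E : Type u} [NormedAddCommGroup E]
    [InnerProductSpace ℝ E] [CompleteSpace E] {T : E →L[ℝ] E}
    (hT : IsCompactOperator T) (hT' : (T : E →ₗ[ℝ] E).IsSymmetric) :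
    ∃ (ι : Type u) (b : HilbertBasis ι ℝ E) (μ : ι → ℝ), ∀ i, T (b i) = μ i • b i := by
  have hc : ∀ μ : ℝ, IsClosed (Module.End.eigenspace (T : Module.End ℝ E) μ : Set E) := fun μ => by
    have : (Module.End.eigenspace (T : Module.End ℝ E) μ : Set E) = {v | T v = μ • v} := by
      ext v
      exact Module.End.mem_eigenspace_iff
    rw [this]
    exact isClosed_eq T.continuous (continuous_const_smul μ)
  have : ∀ μ : ℝ, CompleteSpace (Module.End.eigenspace (T : Module.End ℝ E) μ) := fun μ =>
    (hc μ).completeSpace_coe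
  choose w b hb using fun μ : ℝ =>
    exists_hilbertBasis ℝ (Module.End.eigenspace (T : Module.End ℝ E) μ)
  have ho := hT'.orthogonalFamily_eigenspaces.orthonormal_sigma_orthonormal
    (fun μ => (b μ).orthonormal)
  refine ⟨_, HilbertBasis.mkOfOrthogonalEqBot ho ?_, Sigma.fst, fun a => ?_⟩
  -- A vector orthogonal to a basis of every eigenspace is orthogonal to every eigenspace, hence
  -- zero by the spectral theorem.
  · rw [eq_bot_iff, ← orthogonalComplement_iSup_eigenspaces_eq_bot hT hT']
    intro x hx
    rw [Submodule.mem_orthogonal] at hx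
    rw [← Submodule.iInf_orthogonal, Submodule.mem_iInf]
    refine fun μ => (Submodule.mem_orthogonal _ _).2 fun u hu => ?_
    have hsum := ((b μ).hasSum_repr ⟨u, hu⟩).mapL
      ((innerSL ℝ x).comp (Module.End.eigenspace (T : Module.End ℝ E) μ).subtypeL)
    rw [real_inner_comm]
    refine hsum.unique ?_
    convert hasSum_zero with i
    have := hx _ (Submodule.subset_span (Set.mem_range_self ⟨μ, i⟩))
    rw [real_inner_comm] at this
    simp only [map_smul]
    exact smul_eq_zero_of_right _ this
  · rw [HilbertBasis.coe_mkOfOrthogonalEqBot]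
    exact Module.End.mem_eigenspace_iff.1 (b a.1 a.2).2

/-- A compact operator with injective adjoint into an infinite-dimensional separable Hilbert space
has a singular value decomposition. -/
theorem SingularSystem.nonempty_of_isCompactOperator [CompleteSpace H] [CompleteSpace E]
    [TopologicalSpace.SeparableSpace E] {K : H →L[ℝ] E} (hK : IsCompactOperator K)
    (hinj : ∀ g : E, K.adjoint g = 0 → g = 0) (hE : ¬ FiniteDimensional ℝ E) :
    Nonempty (SingularSystem K) := by
  have hT : IsCompactOperator (K ∘L K.adjoint) := hK.comp_clm _
  have hsymm : ((K ∘L K.adjoint : E →L[ℝ] E) : E →ₗ[ℝ] E).IsSymmetric := fun u v => by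
    change inner ℝ (K (K.adjoint u)) v = inner ℝ u (K (K.adjoint v))
    rw [← K.adjoint_inner_right, ← K.adjoint_inner_left]
  obtain ⟨ι, b, μ, hμ⟩ := exists_hilbertBasis_eigenvectors hT hsymm
  have : Countable ι := b.orthonormal.countable
  -- A `SingularSystem` is indexed by all of `ℕ`, so a finite eigenbasis would not do.
  have : Infinite ι := by
    by_contra hfin
    have : Finite ι := not_infinite_iff_finite.1 hfin
    have := Fintype.ofFinite ι
    exact hE (Module.Basis.finiteDimensional_of_finite b.toOrthonormalBasis.toBasis)
  obtain ⟨e⟩ : Nonempty (ι ≃ ℕ) := nonempty_equiv_of_countable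
  have hin : ∀ i j, inner ℝ (K.adjoint (b i)) (K.adjoint (b j)) = μ j * inner ℝ (b i) (b j) :=
    fun i j => by
      rw [ContinuousLinearMap.adjoint_inner_left, ← inner_smul_right, ← hμ j]; rfl
  have hnorm : ∀ i, ‖K.adjoint (b i)‖ ^ 2 = μ i := fun i => by
    rw [← real_inner_self_eq_norm_sq, hin, real_inner_self_eq_norm_sq, b.orthonormal.1]; simp
  have hpos : ∀ i, 0 < ‖K.adjoint (b i)‖ := fun i => by
    rw [norm_pos_iff]
    intro h0
    have := b.orthonormal.1 i
    rw [hinj _ h0] at this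
    simp at this
  have hφ : Orthonormal ℝ fun i => ‖K.adjoint (b i)‖⁻¹ • K.adjoint (b i) := by
    refine ⟨fun i => ?_, fun i j hij => ?_⟩
    · rw [norm_smul, norm_inv, norm_norm, inv_mul_cancel₀ (hpos i).ne']
    · simp only [inner_smul_left, inner_smul_right, hin, b.orthonormal.2 hij, mul_zero]
  -- The required expansion is that of `K h` in the basis `b`, because `⟨b_n, K h⟩ = ⟨K† b_n, h⟩`.
  refine ⟨⟨fun n => ‖K.adjoint (b (e.symm n))‖, fun n => _, fun n => b (e.symm n), fun n => hpos _,
    hφ.comp e.symm e.symm.injective, b.orthonormal.comp e.symm e.symm.injective, fun h => ?_⟩⟩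
  have := b.hasSum_repr (K h)
  rw [← e.symm.hasSum_iff] at this
  convert this using 3 with n
  simp only [Function.comp, b.repr_apply_apply, inner_smul_left, ← K.adjoint_inner_left]
  rw [← mul_assoc]
  simp [(hpos _).ne']

/-- **Picard's theorem**: if `K†` is injective, `K h = r` is solvable as soon as
`∑ λ_n⁻² ⟨ψ_n, r⟩² < ∞`. -/
theorem SingularSystem.exists_apply_eq [CompleteSpace H] [CompleteSpace E] {K : H →L[ℝ] E}
    (S : SingularSystem K) (hinj : ∀ g : E, K.adjoint g = 0 → g = 0) (r : E)
    (hr : Summable fun n => (S.value n ^ 2)⁻¹ * |inner ℝ r (S.left n)| ^ 2) :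
    ∃ h, K h = r := by
  have hK : ∀ n, K (S.right n) = S.value n • S.left n := fun n => by
    refine (S.hasSum_apply (S.right n)).unique ?_
    convert hasSum_single n fun m hm => ?_ using 1
    · simp [S.orthonormal_right.1 n]
    · simp [S.orthonormal_right.2 hm]
  -- If `g` is orthogonal to every `ψ_n`, then `⟨g, K h⟩ = 0` for all `h`, so `K† g = 0`.
  have hcomplete : (Submodule.span ℝ (Set.range S.left))ᗮ = ⊥ := by
    refine (Submodule.eq_bot_iff _).2 fun g hg => hinj g ?_
    refine ext_inner_right ℝ fun h => ?_
    rw [ContinuousLinearMap.adjoint_inner_left, inner_zero_left]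
    have h1 := (S.hasSum_apply h).mapL (innerSL ℝ g)
    refine h1.unique ?_
    convert hasSum_zero with n
    have := (Submodule.mem_orthogonal' _ _).1 hg (S.left n)
      (Submodule.subset_span (Set.mem_range_self n))
    simp [this]
  let b := HilbertBasis.mkOfOrthogonalEqBot S.orthonormal_left hcomplete
  have hb : ∀ n, b n = S.left n := fun n => by simp [b]
  -- The solution is the sum of this series; the `φ_n` being orthonormal, it converges exactly when
  -- its squared coefficients are summable.
  have hs : Summable fun n => ((S.value n)⁻¹ * inner ℝ (S.left n) r) • S.right n := by
    have := S.orthonormal_right.orthogonalFamily.summable_iff_norm_sq_summable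
      (fun n => (S.value n)⁻¹ * inner ℝ (S.left n) r)
    simp only [LinearIsometry.toSpanSingleton_apply] at this
    rw [this]
    refine hr.congr fun n => ?_
    rw [real_inner_comm, norm_mul, mul_pow, norm_inv, inv_pow, Real.norm_eq_abs, Real.norm_eq_abs,
      sq_abs, sq_abs]
  refine ⟨_, (hs.hasSum.mapL K).unique ?_⟩
  convert b.hasSum_repr r using 2 with n
  rw [map_smul, hK, smul_smul, b.repr_apply_apply, hb]
  congr 1
  field_simp [(S.value_pos n).ne']

end HilbertSpace

/-! ### Infinite-dimensionality of `L²` of an atomless measure. -/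

section LpSpace

open Polynomial in
/-- `L²(μ)` is infinite-dimensional for a nonzero finite atomless measure `μ` on `ℝ`. -/
theorem not_finiteDimensional_Lp_two (μ : Measure ℝ) [IsFiniteMeasure μ] [NullSingletonClass μ]
    (hμ : μ ≠ 0) :
    ¬ FiniteDimensional ℝ (Lp ℝ 2 μ) := by
  intro hfin
  -- Polynomials in `arctan t` rather than in `t`: boundedness puts them in `L²` without moment
  -- assumptions.
  have hmem : ∀ p : ℝ[X], MemLp (fun t => p.eval (Real.arctan t)) 2 μ := fun p => by
    obtain ⟨C, hC⟩ :=
      (isCompact_Icc (a := -(Real.pi / 2)) (b := Real.pi / 2)).exists_bound_of_continuousOn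
        p.continuous.continuousOn
    refine MemLp.of_bound (C := C)
      (p.continuous.comp Real.continuous_arctan).aestronglyMeasurable (ae_of_all _ fun t => ?_)
    exact hC _ ⟨(Real.neg_pi_div_two_lt_arctan t).le, (Real.arctan_lt_pi_div_two t).le⟩
  let L : ℝ[X] →ₗ[ℝ] Lp ℝ 2 μ :=
    { toFun := fun p => (hmem p).toLp _
      map_add' := fun p q => by
        rw [← MemLp.toLp_add]
        congr 1
        ext t
        simp
      map_smul' := fun c p => by
        rw [RingHom.id_apply, ← MemLp.toLp_const_smul]
        congr 1
        ext t
        simp }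
  have hL : Function.Injective L := by
    rw [injective_iff_map_eq_zero]
    intro p hp
    by_contra hp0
    have h0 : (fun t => p.eval (Real.arctan t)) =ᵐ[μ] 0 := by
      have := MemLp.coeFn_toLp (hmem p)
      have h1 : (hmem p).toLp _ = 0 := hp
      rw [h1] at this
      exact this.symm.trans (Lp.coeFn_zero _ _ _)
    have hnull : μ (Real.arctan ⁻¹' {u | p.IsRoot u}) = 0 :=
      ((Polynomial.finite_setOfPred_isRoot hp0).preimage
        Real.arctan_injective.injOn).measure_zero μ
    -- The zeros of a nonzero polynomial in `arctan t` are finitely many, hence null, yet almost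
    -- every `t` is one.
    refine hμ (ae_eq_bot.1 (Filter.eventually_false_iff_eq_bot.1 ?_))
    filter_upwards [h0, measure_eq_zero_iff_ae_notMem.1 hnull] with t h1 h2
    exact h2 h1
  exact Polynomial.not_finite (R := ℝ) (Module.Finite.of_injective L hL)

end LpSpace

/-! ### Conditional laws and Bayes' rule. -/

namespace JointDensity

variable {𝒳 𝒴 : Type*} [MeasurableSpace 𝒳] [MeasurableSpace 𝒴]
  {ρ : Measure 𝒳} {ν : Measure 𝒴} (f : JointDensity ρ ν) [SFinite ν] {x : 𝒳}

theorem measurable_wGivenX (x : 𝒳) : Measurable fun w => f.wGivenX w x :=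
  (f.measurable_fWX x).div_const _

theorem measurable_zGivenX (x : 𝒳) : Measurable fun z => f.zGivenX z x :=
  (f.measurable_fZX x).div_const _

theorem measurable_fWZX_left (x : 𝒳) (z : ℝ) : Measurable fun w => f.fWZX w z x :=
  (f.measurable_fWZX x).comp (by fun_prop : Measurable fun w : ℝ => (w, z))

theorem measurable_fWZX_right (x : 𝒳) (w : ℝ) : Measurable fun z => f.fWZX w z x :=
  (f.measurable_fWZX x).comp (by fun_prop : Measurable fun z : ℝ => (w, z))

theorem lintegral_fWX (x : 𝒳) : ∫⁻ w, f.fWX w x = f.fX x :=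
  lintegral_lintegral_swap (f := fun w z => f.fWZX w z x) (f.measurable_fWZX x).aemeasurable

theorem ae_fWX_lt_top (hx : f.fX x < ∞) : ∀ᵐ w, f.fWX w x < ∞ :=
  ae_lt_top (f.measurable_fWX x) ((f.lintegral_fWX x).trans_lt hx).ne

theorem ae_fZX_lt_top (hx : f.fX x < ∞) : ∀ᵐ z, f.fZX z x < ∞ :=
  ae_lt_top (f.measurable_fZX x) hx.ne

theorem ae_wGivenX_lt_top (hx0 : 0 < f.fX x) (hx : f.fX x < ∞) : ∀ᵐ w, f.wGivenX w x < ∞ :=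
  (f.ae_fWX_lt_top hx).mono fun _ h => ENNReal.div_lt_top h.ne hx0.ne'

theorem ae_zGivenX_lt_top (hx0 : 0 < f.fX x) (hx : f.fX x < ∞) : ∀ᵐ z, f.zGivenX z x < ∞ :=
  (f.ae_fZX_lt_top hx).mono fun _ h => ENNReal.div_lt_top h.ne hx0.ne'

theorem isProbabilityMeasure_lawW (hx0 : 0 < f.fX x) (hx : f.fX x < ∞) :
    IsProbabilityMeasure (f.lawW x) := by
  refine ⟨?_⟩
  rw [lawW, withDensity_apply _ MeasurableSet.univ, Measure.restrict_univ]
  simp only [wGivenX, div_eq_mul_inv]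
  rw [lintegral_mul_const _ (f.measurable_fWX x), lintegral_fWX]
  exact ENNReal.mul_inv_cancel hx0.ne' hx.ne

theorem isProbabilityMeasure_lawZ (hx0 : 0 < f.fX x) (hx : f.fX x < ∞) :
    IsProbabilityMeasure (f.lawZ x) := by
  refine ⟨?_⟩
  rw [lawZ, withDensity_apply _ MeasurableSet.univ, Measure.restrict_univ]
  simp only [zGivenX, div_eq_mul_inv]
  rw [lintegral_mul_const _ (f.measurable_fZX x)]
  exact ENNReal.mul_inv_cancel hx0.ne' hx.ne

theorem not_finiteDimensional_Lp_lawZ (hx0 : 0 < f.fX x) (hx : f.fX x < ∞) :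
    ¬ FiniteDimensional ℝ (Lp ℝ 2 (f.lawZ x)) := by
  have := f.isProbabilityMeasure_lawZ hx0 hx
  have : NullSingletonClass (f.lawZ x) :=
    ⟨fun z => withDensity_absolutelyContinuous _ _ (measure_singleton z)⟩
  exact not_finiteDimensional_Lp_two _ (IsProbabilityMeasure.ne_zero _)

/-- Bayes' rule: `f(z | x) f(w | z, x) = f(w, z | x)`. -/
theorem zGivenX_mul_wGivenZX (hx : f.fX x < ∞) : ∀ᵐ z, ∀ᵐ w,
    f.zGivenX z x * f.wGivenZX w z x = f.fWZX w z x / f.fX x := by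
  filter_upwards [f.ae_fZX_lt_top hx] with z hz
  -- Where `f(z, x) = 0`, the joint density vanishes for almost every `w`, so both sides are zero.
  rcases eq_or_ne (f.fZX z x) 0 with h0 | h0
  · filter_upwards [(lintegral_eq_zero_iff (f.measurable_fWZX_left x z)).1 h0] with w hw
    have hw : f.fWZX w z x = 0 := hw
    simp [wGivenZX, hw]
  · refine ae_of_all _ fun w => ?_
    rw [zGivenX, wGivenZX, mul_comm, ← mul_div_assoc, ENNReal.div_mul_cancel h0 hz.ne]

/-- Bayes' rule: `f(w | x) f(z | w, x) = f(w, z | x)`. -/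
theorem wGivenX_mul_zGivenWX (hx : f.fX x < ∞) : ∀ᵐ w, ∀ᵐ z,
    f.wGivenX w x * f.zGivenWX z w x = f.fWZX w z x / f.fX x := by
  filter_upwards [f.ae_fWX_lt_top hx] with w hw
  rcases eq_or_ne (f.fWX w x) 0 with h0 | h0
  · filter_upwards [(lintegral_eq_zero_iff (f.measurable_fWZX_right x w)).1 h0] with z hz
    have hz : f.fWZX w z x = 0 := hz
    simp [zGivenWX, hz]
  · refine ae_of_all _ fun z => ?_
    rw [wGivenX, zGivenWX, mul_comm, ← mul_div_assoc, ENNReal.div_mul_cancel h0 hw.ne]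

theorem integral_lawW (hx0 : 0 < f.fX x) (hx : f.fX x < ∞) (h : ℝ → ℝ) :
    ∫ w, h w ∂(f.lawW x) = ∫ w, (f.wGivenX w x).toReal * h w :=
  integral_withDensity_eq_integral_toReal_smul (f.measurable_wGivenX x)
    (f.ae_wGivenX_lt_top hx0 hx) h

theorem integral_lawZ (hx0 : 0 < f.fX x) (hx : f.fX x < ∞) (g : ℝ → ℝ) :
    ∫ z, g z ∂(f.lawZ x) = ∫ z, (f.zGivenX z x).toReal * g z :=
  integral_withDensity_eq_integral_toReal_smul (f.measurable_zGivenX x)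
    (f.ae_zGivenX_lt_top hx0 hx) g

/-! ### The adjoint of the conditional expectation operator -/

/-- `g(z) f(w, z | x)` is integrable whenever `g` is integrable for `F(z | x)`. -/
theorem integrable_mul_fWZX {g : ℝ → ℝ} (hg : Measurable g)
    (hgi : Integrable g (f.lawZ x)) :
    Integrable fun t : ℝ × ℝ => g t.2 * (f.fWZX t.1 t.2 x / f.fX x).toReal := by
  have hm : Measurable fun t : ℝ × ℝ => g t.2 * (f.fWZX t.1 t.2 x / f.fX x).toReal :=
    (hg.comp measurable_snd).mul ((f.measurable_fWZX x).div_const _).ennreal_toReal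
  refine ⟨hm.aestronglyMeasurable, ?_⟩
  refine lt_of_le_of_lt ?_ hgi.2
  rw [Measure.volume_eq_prod, lintegral_prod_symm' _ hm.enorm, lawZ,
    lintegral_withDensity_eq_lintegral_mul _ (f.measurable_zGivenX x) hg.enorm]
  refine lintegral_mono fun z => ?_
  have hle : ∀ w, ‖g z * (f.fWZX w z x / f.fX x).toReal‖ₑ ≤
      ‖g z‖ₑ * (f.fWZX w z x / f.fX x) := fun w => by
    rw [enorm_mul, Real.enorm_eq_ofReal ENNReal.toReal_nonneg]
    gcongr
    exact ENNReal.ofReal_toReal_le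
  refine (lintegral_mono hle).trans (le_of_eq ?_)
  simp only [div_eq_mul_inv]
  rw [lintegral_const_mul _ ((f.measurable_fWZX_left x z).mul_const _),
    lintegral_mul_const _ (f.measurable_fWZX_left x z), Pi.mul_apply, mul_comm]
  rfl

theorem coeFn_condExpOp (h : Lp ℝ 2 (f.lawW x)) :
    f.condExpOp x h =ᵐ[f.lawZ x] f.condExpW x h :=
  (f.memLp_condExpW x h).coeFn_toLp

/-- Almost surely `E{g(Z) | w, x} f(w | x) = ∫ g(z) f(w, z | x) dz`. -/
theorem wGivenX_mul_condExpZ (hx : f.fX x < ∞) (g : ℝ → ℝ) : ∀ᵐ w,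
    (f.wGivenX w x).toReal * f.condExpZ x g w =
      ∫ z, g z * (f.fWZX w z x / f.fX x).toReal := by
  filter_upwards [f.wGivenX_mul_zGivenWX hx] with w hw
  rw [condExpZ, ← integral_const_mul]
  refine integral_congr_ae ?_
  filter_upwards [hw] with z hz
  rw [← hz, ENNReal.toReal_mul]
  ring

/-- Almost surely `E{h(W) | z, x} f(z | x) = ∫ h(w) f(w, z | x) dw`. -/
theorem zGivenX_mul_condExpW (hx : f.fX x < ∞) (h : ℝ → ℝ) : ∀ᵐ z,
    (f.zGivenX z x).toReal * f.condExpW x h z =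
      ∫ w, h w * (f.fWZX w z x / f.fX x).toReal := by
  filter_upwards [f.zGivenX_mul_wGivenZX hx] with z hz
  rw [condExpW, ← integral_const_mul]
  refine integral_congr_ae ?_
  filter_upwards [hz] with w hw
  rw [← hw, ENNReal.toReal_mul]
  ring

/-- `E[1_s(W) E{g(Z) | W, x} | x] = E[g(Z) E{1_s(W) | Z, x} | x]`. -/
theorem setIntegral_condExpZ (hx0 : 0 < f.fX x) (hx : f.fX x < ∞) {g : ℝ → ℝ} (hg : Measurable g)
    (hgi : Integrable g (f.lawZ x)) {s : Set ℝ} (hs : MeasurableSet s) :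
    ∫ w in s, f.condExpZ x g w ∂(f.lawW x) =
      ∫ z, g z * f.condExpW x (s.indicator 1) z ∂(f.lawZ x) := by
  have hG := f.integrable_mul_fWZX hg hgi
  have hGs : Integrable (Function.uncurry fun w z : ℝ =>
      s.indicator (1 : ℝ → ℝ) w * (g z * (f.fWZX w z x / f.fX x).toReal))
      (volume.prod volume) := by
    rw [← Measure.volume_eq_prod]
    refine (hG.indicator (measurable_fst hs)).congr (ae_of_all _ fun t => ?_)
    by_cases ht : t.1 ∈ s
    · simp [Function.uncurry, ht]
    · simp [Function.uncurry, ht]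
  calc ∫ w in s, f.condExpZ x g w ∂(f.lawW x)
      = ∫ w, (f.wGivenX w x).toReal * (s.indicator (1 : ℝ → ℝ) w * f.condExpZ x g w) := by
        rw [← integral_indicator hs, f.integral_lawW hx0 hx]
        refine integral_congr_ae (ae_of_all _ fun w => ?_)
        by_cases hw : w ∈ s <;> simp [hw]
    _ = ∫ w, ∫ z, s.indicator (1 : ℝ → ℝ) w * (g z * (f.fWZX w z x / f.fX x).toReal) := by
        refine integral_congr_ae ?_
        filter_upwards [f.wGivenX_mul_condExpZ hx g] with w hw
        rw [integral_const_mul, ← hw]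
        ring
    _ = ∫ z, ∫ w, s.indicator (1 : ℝ → ℝ) w * (g z * (f.fWZX w z x / f.fX x).toReal) :=
        integral_integral_swap hGs
    _ = ∫ z, (f.zGivenX z x).toReal * (g z * f.condExpW x (s.indicator 1) z) := by
        refine integral_congr_ae ?_
        filter_upwards [f.zGivenX_mul_condExpW hx (s.indicator 1)] with z hz
        rw [mul_left_comm, hz, ← integral_const_mul]
        refine integral_congr_ae (ae_of_all _ fun w => ?_)
        ring
    _ = _ := (f.integral_lawZ hx0 hx _).symm

theorem integrable_condExpZ (hx0 : 0 < f.fX x) (hx : f.fX x < ∞) {g : ℝ → ℝ} (hg : Measurable g)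
    (hgi : Integrable g (f.lawZ x)) : Integrable (f.condExpZ x g) (f.lawW x) := by
  rw [lawW, integrable_withDensity_iff_integrable_smul' (f.measurable_wGivenX x)
    (f.ae_wGivenX_lt_top hx0 hx)]
  have hG := f.integrable_mul_fWZX hg hgi
  rw [Measure.volume_eq_prod] at hG
  refine hG.integral_prod_left.congr ?_
  filter_upwards [f.wGivenX_mul_condExpZ hx g] with w hw
  exact hw.symm

/-- It suffices that `E{g(Z) | w, x}` integrates to zero over every measurable `s`. By Fubini this
integral is `⟨g, K_x 1_s⟩ = ⟨K_x† g, 1_s⟩`, so no formula for `K_x†` is needed. -/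
theorem condExpZ_ae_eq_zero (hx0 : 0 < f.fX x) (hx : f.fX x < ∞) (g : Lp ℝ 2 (f.lawZ x))
    (hg : (f.condExpOp x).adjoint g = 0) : ∀ᵐ w ∂(f.lawW x), f.condExpZ x g w = 0 := by
  have := f.isProbabilityMeasure_lawW hx0 hx
  have := f.isProbabilityMeasure_lawZ hx0 hx
  have hgm := (Lp.stronglyMeasurable g).measurable
  have hgi : Integrable g (f.lawZ x) := (Lp.memLp g).integrable (by norm_num)
  refine (f.integrable_condExpZ hx0 hx hgm hgi).ae_eq_zero_of_forall_setIntegral_eq_zero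
    fun s hs _ => ?_
  rw [f.setIntegral_condExpZ hx0 hx hgm hgi hs]
  have h0 : inner ℝ g (f.condExpOp x (indicatorConstLp 2 hs (measure_ne_top _ s) 1)) = 0 := by
    rw [← ContinuousLinearMap.adjoint_inner_left, hg, inner_zero_left]
  rw [L2.inner_def] at h0
  rw [← h0]
  refine integral_congr_ae ?_
  filter_upwards [f.coeFn_condExpOp (indicatorConstLp 2 hs (measure_ne_top _ s) 1),
    f.condExpW_congr_ae x (indicatorConstLp_coeFn (hs := hs) (c := (1 : ℝ)) (p := 2)
      (hμs := measure_ne_top (f.lawW x) s))] with z h1 h2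
  rw [h1, h2]
  simp only [RCLike.inner_apply, conj_trivial]
  rw [mul_comm]
  rfl

theorem adjoint_injective (hx0 : 0 < f.fX x) (hx : f.fX x < ∞) (hc : f.IsCompleteAt x)
    (g : Lp ℝ 2 (f.lawZ x)) (hg : (f.condExpOp x).adjoint g = 0) : g = 0 := by
  rw [Lp.eq_zero_iff_ae_eq_zero]
  exact (hc g (Lp.memLp g)).1 (f.condExpZ_ae_eq_zero hx0 hx g hg)

/-! ### Compactness -/

/-- The kernel `f(w | z, x) / f(w | x)` of the conditional expectation operator with respect to
`F(w | x)`. -/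
noncomputable def kernelW (x : 𝒳) (z w : ℝ) : ℝ≥0∞ := f.wGivenZX w z x / f.wGivenX w x

theorem measurable_kernelW (x : 𝒳) : Measurable fun t : ℝ × ℝ => f.kernelW x t.2 t.1 :=
  (f.measurable_wGivenZX x).div ((f.measurable_wGivenX x).comp measurable_fst)

theorem measurable_kernelW_right (x : 𝒳) (z : ℝ) : Measurable fun w => f.kernelW x z w :=
  (f.measurable_kernelW x).comp (by fun_prop : Measurable fun w : ℝ => (w, z))

theorem measurable_lintegral_kernelW_sq (hx0 : 0 < f.fX x) (hx : f.fX x < ∞) :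
    Measurable fun z => ∫⁻ w, f.kernelW x z w ^ 2 ∂(f.lawW x) := by
  have := f.isProbabilityMeasure_lawW hx0 hx
  exact ((f.measurable_kernelW x).pow_const 2).lintegral_prod_left'

-- Equality can fail where a marginal density is `0` or `∞`; the inequality needs no case split and
-- suffices for the Hilbert–Schmidt bound.
omit [SFinite ν] in
theorem zGivenX_mul_kernelW_le (hx0 : 0 < f.fX x) (hx : f.fX x < ∞) (z w : ℝ) :
    f.zGivenX z x * f.kernelW x z w ≤ f.zGivenWX z w x := by
  have h1 : f.fZX z x * (f.fWZX w z x / f.fZX z x) ≤ f.fWZX w z x := ENNReal.mul_div_le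
  calc f.zGivenX z x * f.kernelW x z w
      = (f.fZX z x * (f.fWZX w z x / f.fZX z x)) * ((f.fX x)⁻¹ / f.wGivenX w x) := by
        simp only [zGivenX, kernelW, wGivenZX, div_eq_mul_inv]; ring
    _ ≤ f.fWZX w z x * ((f.fX x)⁻¹ / f.wGivenX w x) := by gcongr
    _ = f.zGivenWX z w x := by
        rw [zGivenWX, wGivenX, div_eq_mul_inv, div_eq_mul_inv, div_eq_mul_inv,
          ENNReal.mul_inv (Or.inr (ENNReal.inv_ne_top.2 hx0.ne'))
            (Or.inr (ENNReal.inv_ne_zero.2 hx.ne)), inv_inv, mul_left_comm (f.fX x)⁻¹,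
          ENNReal.inv_mul_cancel hx0.ne' hx.ne, mul_one]

/-- Split the squared kernel into two factors: the weight `f(w | x)` turns one into `f(w | z, x)`,
and `f(z | x)` turns the other into `f(z | w, x)`. -/
theorem lintegral_kernelW_sq_le (hx0 : 0 < f.fX x) (hx : f.fX x < ∞) :
    ∫⁻ z, ∫⁻ w, f.kernelW x z w ^ 2 ∂(f.lawW x) ∂(f.lawZ x) ≤
      ∫⁻ z, ∫⁻ w, f.wGivenZX w z x * f.zGivenWX z w x := by
  have hm := f.measurable_lintegral_kernelW_sq hx0 hx
  rw [lawZ, lintegral_withDensity_eq_lintegral_mul _ (f.measurable_zGivenX x) hm]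
  refine lintegral_mono fun z => ?_
  have hk := f.measurable_kernelW_right x z
  rw [Pi.mul_apply, lawW, lintegral_withDensity_eq_lintegral_mul _ (f.measurable_wGivenX x)
    (hk.pow_const 2), ← lintegral_const_mul _ ((f.measurable_wGivenX x).mul (hk.pow_const 2))]
  refine lintegral_mono fun w => ?_
  have h1 : f.wGivenX w x * f.kernelW x z w ≤ f.wGivenZX w z x := ENNReal.mul_div_le
  calc f.zGivenX z x * (f.wGivenX w x * f.kernelW x z w ^ 2)
      = (f.wGivenX w x * f.kernelW x z w) * (f.zGivenX z x * f.kernelW x z w) := by ring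
    _ ≤ _ := mul_le_mul' h1 (f.zGivenX_mul_kernelW_le hx0 hx z w)

theorem wGivenX_mul_kernelW (hx0 : 0 < f.fX x) (hx : f.fX x < ∞) :
    ∀ᵐ z, ∀ᵐ w, f.wGivenX w x * f.kernelW x z w = f.wGivenZX w z x := by
  have hm : MeasurableSet
      {t : ℝ × ℝ | f.wGivenX t.1 x * f.kernelW x t.2 t.1 = f.wGivenZX t.1 t.2 x} :=
    measurableSet_eq_fun (((f.measurable_wGivenX x).comp measurable_fst).mul
      (f.measurable_kernelW x)) (f.measurable_wGivenZX x)
  -- The degenerate case `f(w, x) = 0` is controlled for fixed `w`, hence the exchange of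
  -- quantifiers.
  rw [← Measure.ae_ae_comm hm]
  filter_upwards [f.ae_wGivenX_lt_top hx0 hx] with w hw
  rcases eq_or_ne (f.fWX w x) 0 with h0 | h0
  · filter_upwards [(lintegral_eq_zero_iff (f.measurable_fWZX_right x w)).1 h0] with z hz
    have hz : f.fWZX w z x = 0 := hz
    simp [kernelW, wGivenZX, hz]
  · exact ae_of_all _ fun z => ENNReal.mul_div_cancel
      (ENNReal.div_ne_zero.2 ⟨h0, hx.ne⟩) hw.ne

/-- Off a null set of `z`, `K_x` is integration against the kernel. -/
theorem condExpW_eq_integral_kernelW (hx0 : 0 < f.fX x) (hx : f.fX x < ∞) :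
    ∀ᵐ z, ∀ h : ℝ → ℝ, f.condExpW x h z = ∫ w, (f.kernelW x z w).toReal * h w ∂(f.lawW x) := by
  filter_upwards [f.wGivenX_mul_kernelW hx0 hx] with z hz h
  rw [f.integral_lawW hx0 hx, condExpW]
  refine integral_congr_ae ?_
  filter_upwards [hz] with w hw
  rw [← hw, ENNReal.toReal_mul]
  ring

omit [SFinite ν] in
theorem eLpNorm_kernelW_sq_le (x : 𝒳) (z : ℝ) :
    eLpNorm (fun w => (f.kernelW x z w).toReal) 2 (f.lawW x) ^ 2 ≤
      ∫⁻ w, f.kernelW x z w ^ 2 ∂(f.lawW x) := by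
  rw [← lintegral_enorm_sq_eq]
  refine lintegral_mono fun w => ?_
  gcongr
  rw [Real.enorm_eq_ofReal ENNReal.toReal_nonneg]
  exact ENNReal.ofReal_toReal_le

theorem ae_memLp_kernelW (hx0 : 0 < f.fX x) (hx : f.fX x < ∞) (hs : f.HilbertSchmidtAt x) :
    ∀ᵐ z ∂(f.lawZ x), MemLp (fun w => (f.kernelW x z w).toReal) 2 (f.lawW x) := by
  filter_upwards [ae_lt_top (f.measurable_lintegral_kernelW_sq hx0 hx)
    ((f.lintegral_kernelW_sq_le hx0 hx).trans_lt hs).ne] with z hz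
  refine ⟨(f.measurable_kernelW_right x z).ennreal_toReal.aestronglyMeasurable, ?_⟩
  exact (ENNReal.pow_lt_top_iff.1 ((f.eLpNorm_kernelW_sq_le x z).trans_lt hz)).resolve_right
    two_ne_zero

/-- Bessel's inequality, applied to the kernel at almost every `z`. -/
theorem sum_enorm_condExpW_sq_le (hx0 : 0 < f.fX x) (hx : f.fX x < ∞)
    (hs : f.HilbertSchmidtAt x) {ι : Type*} {v : ι → Lp ℝ 2 (f.lawW x)} (hv : Orthonormal ℝ v)
    (s : Finset ι) :
    ∀ᵐ z ∂(f.lawZ x), ∑ i ∈ s, ‖f.condExpW x (v i) z‖ₑ ^ 2 ≤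
      ∫⁻ w, f.kernelW x z w ^ 2 ∂(f.lawW x) := by
  filter_upwards [f.ae_memLp_kernelW hx0 hx hs, (withDensity_absolutelyContinuous _ _).ae_le
    (f.condExpW_eq_integral_kernelW hx0 hx)] with z hk hz
  refine le_trans ?_ (f.eLpNorm_kernelW_sq_le x z)
  -- At a fixed good `z`, the values `(K_x v_i)(z)` are the coefficients of a single `L²` function,
  -- the kernel at `z`.
  have hin : ∀ i, f.condExpW x (v i) z = inner ℝ (v i) (hk.toLp _) := fun i => by
    rw [hz, L2.inner_def]
    refine integral_congr_ae ?_
    filter_upwards [hk.coeFn_toLp] with w hw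
    rw [hw]
    simp
  have hb := ENNReal.ofReal_le_ofReal (hv.sum_inner_products_le (s := s) (hk.toLp _))
  rw [ENNReal.ofReal_sum_of_nonneg fun _ _ => by positivity] at hb
  simp only [ENNReal.ofReal_pow (norm_nonneg _), ofReal_norm] at hb
  simpa only [hin, ← Lp.enorm_toLp hk] using hb

theorem enorm_condExpOp_sq (h : Lp ℝ 2 (f.lawW x)) :
    ‖f.condExpOp x h‖ₑ ^ 2 = ∫⁻ z, ‖f.condExpW x h z‖ₑ ^ 2 ∂(f.lawZ x) := by
  rw [Lp.enorm_def, eLpNorm_congr_ae (f.coeFn_condExpOp h), lintegral_enorm_sq_eq]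

/-- Integrating the pointwise Bessel inequality over `z` bounds every finite sum independently of
`s`, which gives the summability needed for compactness. -/
theorem sum_norm_condExpOp_sq_le (hx0 : 0 < f.fX x) (hx : f.fX x < ∞) (hs : f.HilbertSchmidtAt x)
    {ι : Type*} {v : ι → Lp ℝ 2 (f.lawW x)} (hv : Orthonormal ℝ v) (s : Finset ι) :
    ∑ i ∈ s, ‖f.condExpOp x (v i)‖ ^ 2 ≤
      (∫⁻ z, ∫⁻ w, f.wGivenZX w z x * f.zGivenWX z w x).toReal := by
  have h1 : ∑ i ∈ s, ‖f.condExpOp x (v i)‖ₑ ^ 2 ≤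
      ∫⁻ z, ∫⁻ w, f.wGivenZX w z x * f.zGivenWX z w x := by
    simp only [enorm_condExpOp_sq]
    rw [← lintegral_finsetSum _ fun i _ =>
      ((f.measurable_condExpW x (Lp.stronglyMeasurable (v i)).measurable).measurable.enorm.pow_const
        2)]
    exact (lintegral_mono_ae (f.sum_enorm_condExpW_sq_le hx0 hx hs hv s)).trans
      (f.lintegral_kernelW_sq_le hx0 hx)
  have h2 := ENNReal.toReal_mono hs.ne h1
  rw [ENNReal.toReal_sum fun _ _ => ENNReal.pow_ne_top enorm_ne_top] at h2
  simpa only [ENNReal.toReal_pow, toReal_enorm] using h2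

theorem isCompactOperator_condExpOp (hx0 : 0 < f.fX x) (hx : f.fX x < ∞)
    (hs : f.HilbertSchmidtAt x) : IsCompactOperator (f.condExpOp x) := by
  obtain ⟨w, b, -⟩ := exists_hilbertBasis ℝ (Lp ℝ 2 (f.lawW x))
  exact isCompactOperator_of_summable_norm_sq _ b
    (summable_of_sum_le (fun _ => by positivity)
      (f.sum_norm_condExpOp_sq_le hx0 hx hs b.orthonormal))

theorem nonempty_singularSystem (hx0 : 0 < f.fX x) (hx : f.fX x < ∞) (hc : f.IsCompleteAt x)
    (hs : f.HilbertSchmidtAt x) : Nonempty (SingularSystem (f.condExpOp x)) := by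
  have := f.isProbabilityMeasure_lawZ hx0 hx
  -- Supplies the instance behind separability of `L²{F(z | x)}`.
  have : Fact ((2 : ℝ≥0∞) ≠ ∞) := ⟨by norm_num⟩
  exact SingularSystem.nonempty_of_isCompactOperator (f.isCompactOperator_condExpOp hx0 hx hs)
    (f.adjoint_injective hx0 hx hc) (f.not_finiteDimensional_Lp_lawZ hx0 hx)

/-! ### The integral equation -/

omit [SFinite ν] in
theorem measurable_fZXY (x : 𝒳) (y : 𝒴) : Measurable fun z => f.fZXY z x y :=
  Measurable.lintegral_prod_left' (f := fun t : ℝ × ℝ => f.toFun t.1 t.2 x y)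
    (f.measurable_toFun.comp (by fun_prop : Measurable fun t : ℝ × ℝ => (t.1, t.2, x, y)))

theorem measurable_prY (x : 𝒳) (y : 𝒴) : Measurable fun z => f.prY y z x :=
  (f.measurable_fZXY x y).div (f.measurable_fZX x)

theorem memLp_prY {y : 𝒴} (h : f.SquareIntegrableAt x y) :
    MemLp (fun z => (f.prY y z x).toReal) 2 (f.lawZ x) := by
  refine ⟨(f.measurable_prY x y).ennreal_toReal.aestronglyMeasurable, ?_⟩
  rw [← ENNReal.pow_lt_top_iff (n := 2) |>.trans (or_iff_left two_ne_zero), ← lintegral_enorm_sq_eq]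
  refine lt_of_le_of_lt ?_ h
  rw [lawZ, lintegral_withDensity_eq_lintegral_mul _ (f.measurable_zGivenX x)
    ((f.measurable_prY x y).ennreal_toReal.enorm.pow_const 2)]
  refine lintegral_mono fun z => ?_
  rw [Pi.mul_apply, mul_comm]
  gcongr
  rw [Real.enorm_eq_ofReal ENNReal.toReal_nonneg]
  exact ENNReal.ofReal_toReal_le

theorem exists_isSolutionAt {y : 𝒴} (hx0 : 0 < f.fX x) (hx : f.fX x < ∞) (hc : f.IsCompleteAt x)
    (hy : f.SquareIntegrableAt x y) (S : SingularSystem (f.condExpOp x)) (hS : f.PicardAt x y S) :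
    ∃ h, f.IsSolutionAt x y h := by
  have hr := f.memLp_prY hy
  obtain ⟨h, hh⟩ := S.exists_apply_eq (f.adjoint_injective hx0 hx hc) (hr.toLp _) (by
    -- The integral in `PicardAt` is the inner product of the `L²` class of `pr(y | ·, x)` with
    -- `ψ_n`.
    refine hS.congr fun n => ?_
    congr 3
    rw [L2.inner_def]
    refine integral_congr_ae ?_
    filter_upwards [hr.coeFn_toLp] with z hz
    rw [hz]
    simp [mul_comm])
  refine ⟨h, (Lp.stronglyMeasurable h).measurable, Lp.memLp h, ?_⟩
  filter_upwards [f.integrable_condExpW x h, f.coeFn_condExpOp h, hr.coeFn_toLp] with z h1 h2 h3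
  refine ⟨h1, ?_⟩
  rw [← h3, ← hh, h2, condExpW]

end JointDensity

theorem proposition1 {𝒳 𝒴 : Type*} [MeasurableSpace 𝒳] [MeasurableSpace 𝒴]
    (ρ : Measure 𝒳) [SigmaFinite ρ] (ν : Measure 𝒴) [SigmaFinite ν] (f : JointDensity ρ ν) :
    (∀ x : 𝒳, 0 < f.fX x → f.fX x < ∞ → f.IsCompleteAt x → f.HilbertSchmidtAt x →
      Nonempty (SingularSystem (f.condExpOp x))) ∧
    ∃ h : ℝ → 𝒳 → 𝒴 → ℝ, ∀ (x : 𝒳) (y : 𝒴), 0 < f.fX x → f.fX x < ∞ →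
      f.IsCompleteAt x → f.HilbertSchmidtAt x → f.SquareIntegrableAt x y →
      ∀ S : SingularSystem (f.condExpOp x), f.PicardAt x y S →
        f.IsSolutionAt x y (fun w => h w x y) := by
  classical
  -- Solutions are chosen separately at each `(x, y)`, with `0` where none exists. The choice does
  -- not depend on `S`, so one `h` serves every decomposition.
  refine ⟨fun x hx0 hx hc hs => f.nonempty_singularSystem hx0 hx hc hs,
    fun w x y => if H : ∃ h, f.IsSolutionAt x y h then H.choose w else 0,
    fun x y hx0 hx hc _ hy S hS => ?_⟩
  have H := f.exists_isSolutionAt hx0 hx hc hy S hS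
  simpa only [dif_pos H] using H.choose_spec
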